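/- Let $D\subset\mathbb{C}$ be a convex hyperbolic region, that is, a nonempty convex open set whose complement $\mathbb{C}\setminus D$ contains at least two points, and let $f:D\to\mathbb{C}$ be a conformal mapping in $D$, that is, analytic and injective on $D$. Let $\lambda_D$ denote the hyperbolic density of $D$ with curvature $-4$, i.e. the function on $D$ determined by $$\lambda_D(p(\zeta))\,|p'(\zeta)|=\frac{1}{1-|\zeta|^2},\qquad |\zeta|<1,$$ for any analytic universal covering map $p$ of the open unit disk onto $D$, and for a region $G\subsetneq\mathbb{C}$ and $w\in G$ let $\delta_G(w)$ denote the Euclidean distance from $w$ to the boundary $\partial G$. Then $$\frac18\,\lambda_D(z)\le\frac{|f'(z)|}{\delta_{f(D)}(f(z))}\le 8\,\lambda_D(z)\qquad\text{for all } z\in D.$$ -/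

import Mathlib

/-- A hyperbolic region: a nonempty connected open subset of the complex plane whose complement
contains at least two points. -/
structure IsHyperbolicRegion (D : Set ℂ) : Prop where
  isOpen : IsOpen D
  isConnected : IsConnected D
  two_points : Dᶜ.Nontrivial

/-- A conformal mapping in `D`: analytic and univalent in `D`. -/
structure IsConformalMapping (f : ℂ → ℂ) (D : Set ℂ) : Prop where
  differentiableOn : DifferentiableOn ℂ f D
  injOn : Set.InjOn f D

/-- An analytic covering map of the open unit disk onto `D`. The disk being simply connected,
this is a universal covering map of `D`. -/
structure IsDiskUniversalCovering (p : ℂ → ℂ) (D : Set ℂ) : Prop where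
  differentiableOn : DifferentiableOn ℂ p (Metric.ball 0 1)
  surjOn : Set.SurjOn p (Metric.ball 0 1) D
  isCoveringMap : ∃ h : Set.MapsTo p (Metric.ball 0 1) D, IsCoveringMap h.restrict

/-- The hyperbolic density of `D` of curvature `-4`: the number `r` such that
`r * |p'(ζ)| = 1 / (1 - |ζ|²)` for a universal covering `p` of `D` by the unit disk and a point
`ζ` of the disk over `w`. For a hyperbolic region this number exists and depends neither on `p`
nor on `ζ`, so the infimum is that of a one-element set. -/
noncomputable def hyperbolicDensity (D : Set ℂ) (w : ℂ) : ℝ :=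
  sInf {r : ℝ | ∃ (p : ℂ → ℂ) (ζ : ℂ), IsDiskUniversalCovering p D ∧ ζ ∈ Metric.ball (0 : ℂ) 1 ∧
    p ζ = w ∧ r * ‖deriv p ζ‖ = 1 / (1 - ‖ζ‖ ^ 2)}

/-- The Euclidean distance from `z` to the boundary of `D`. -/
noncomputable def boundaryDist (D : Set ℂ) (z : ℂ) : ℝ :=
  Metric.infDist z (frontier D)

/-! A convex region other than the plane is simply connected, so there is a Riemann map `p` of the
disk onto `D` with `p 0 = z`, and the hyperbolic density at `z` is `1 / |p' 0|`. The function `g = f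
∘ p` is univalent on the disk, with image `f '' D` and `|g' 0| = |f' z| |p' 0|`. The claim thus
reduces to `δ ≤ |g' 0| ≤ 8 δ`, where `δ` is the distance from `g 0` to the boundary of the image
(`boundaryDist_image_ball_bounds`). Convexity enters only through simple connectivity.

The left inequality is the Schwarz lemma for the inverse of `g`. The right one is a Koebe theorem
with constant 1/8 (`norm_deriv_le_eight_mul`). For an omitted value `c`, a square root `k` of `g -
c` has range disjoint from its negative. A Möbius map with pole at `k 0` turns `k` into `1/z + b z`
and `-k` into a bounded function on smaller disks. The latter's image lies in the complement of the
former's, whose area is bounded by a weak area theorem (`volume_real_le_of_disjoint_image`).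
Comparing areas bounds `|k' 0| / |k 0|`. -/

open Set Filter Metric Topology

/-! ### Inverses and square roots of holomorphic functions -/

section Univalent

variable {U : Set ℂ} {f : ℂ → ℂ}

/-- An injective holomorphic function is a local open map. -/
theorem nhds_le_map_nhds_of_injOn (hU : IsOpen U) (hf : DifferentiableOn ℂ f U)
    (hinj : InjOn f U) {a : ℂ} (ha : a ∈ U) : 𝓝 (f a) ≤ map f (𝓝 a) := by
  refine (hf.analyticAt (hU.mem_nhds ha)).eventually_constant_or_nhds_le_map_nhds.resolve_left ?_
  intro h
  have h1 : ∀ᶠ z in 𝓝[≠] a, z ∈ U ∧ f z = f a :=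
    ((hU.eventually_mem ha).and h).filter_mono nhdsWithin_le_nhds
  obtain ⟨z, ⟨hzU, hz⟩, hne⟩ := (h1.and self_mem_nhdsWithin).exists
  exact hne (hinj hzU ha hz)

theorem isOpen_image_of_injOn (hU : IsOpen U) (hf : DifferentiableOn ℂ f U)
    (hinj : InjOn f U) {V : Set ℂ} (hV : IsOpen V) (hVU : V ⊆ U) : IsOpen (f '' V) := by
  rw [isOpen_iff_mem_nhds]
  rintro _ ⟨a, ha, rfl⟩
  exact nhds_le_map_nhds_of_injOn hU hf hinj (hVU ha) (image_mem_map (hV.mem_nhds ha))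

theorem continuousAt_invFunOn (hU : IsOpen U) (hf : DifferentiableOn ℂ f U)
    (hinj : InjOn f U) {a : ℂ} (ha : a ∈ U) : ContinuousAt (Function.invFunOn f U) (f a) := by
  have hinv := hinj.leftInvOn_invFunOn
  rw [ContinuousAt, hinv ha]
  intro N hN
  have : f '' (N ∩ U) ∈ 𝓝 (f a) :=
    nhds_le_map_nhds_of_injOn hU hf hinj ha (image_mem_map (inter_mem hN (hU.mem_nhds ha)))
  rw [mem_map]
  filter_upwards [this]
  rintro _ ⟨b, ⟨hbN, hbU⟩, rfl⟩
  simpa [hinv hbU] using hbN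

theorem hasDerivAt_invFunOn_of_deriv_ne_zero (hU : IsOpen U) (hf : DifferentiableOn ℂ f U)
    (hinj : InjOn f U) {a : ℂ} (ha : a ∈ U) (hd : deriv f a ≠ 0) :
    HasDerivAt (Function.invFunOn f U) (deriv f a)⁻¹ (f a) := by
  have hinv := hinj.leftInvOn_invFunOn
  refine HasDerivAt.of_local_left_inverse (f := f) (continuousAt_invFunOn hU hf hinj ha) ?_ hd ?_
  · rw [hinv ha]
    exact (hf.differentiableAt (hU.mem_nhds ha)).hasDerivAt
  · filter_upwards [(isOpen_image_of_injOn hU hf hinj hU Subset.rfl).mem_nhds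
      (mem_image_of_mem f ha)]
    rintro _ ⟨b, hb, rfl⟩
    rw [hinv hb]

/-- The inverse of an injective holomorphic function is holomorphic. -/
theorem differentiableAt_invFunOn (hU : IsOpen U) (hf : DifferentiableOn ℂ f U)
    (hinj : InjOn f U) {a : ℂ} (ha : a ∈ U) :
    DifferentiableAt ℂ (Function.invFunOn f U) (f a) := by
  have hfa := hf.analyticAt (hU.mem_nhds ha)
  have hne : ∀ᶠ z in 𝓝[≠] a, deriv f z ≠ 0 := by
    refine hfa.deriv.eventually_eq_zero_or_eventually_ne_zero.resolve_left ?_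
    intro h
    obtain ⟨r, hr, hball⟩ := Metric.eventually_nhds_iff_ball.1
      (h.and (hU.eventually_mem ha))
    obtain ⟨b, hb, hba⟩ : ∃ b ∈ ball a r, b ≠ a := by
      have h2 : ∀ᶠ z in 𝓝[≠] a, z ∈ ball a r :=
        (isOpen_ball.eventually_mem (mem_ball_self hr)).filter_mono nhdsWithin_le_nhds
      obtain ⟨b, hb, hb'⟩ := (h2.and self_mem_nhdsWithin).exists
      exact ⟨b, hb, hb'⟩
    refine hba (hinj (hball b hb).2 ha ?_)
    exact isOpen_ball.is_const_of_deriv_eq_zero (convex_ball a r).isPreconnected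
      (hf.mono fun z hz => (hball z hz).2) (fun z hz => (hball z hz).1) hb (mem_ball_self hr)
  obtain ⟨r, hr, hball⟩ := Metric.eventually_nhds_iff_ball.1 (eventually_nhdsWithin_iff.1 hne)
  have hopen : IsOpen (f '' (U ∩ ball a r)) :=
    isOpen_image_of_injOn hU hf hinj (hU.inter isOpen_ball) inter_subset_left
  have hmem : f '' (U ∩ ball a r) ∈ 𝓝 (f a) :=
    hopen.mem_nhds (mem_image_of_mem f ⟨ha, mem_ball_self hr⟩)
  -- Zeros of the derivative are isolated, so the inverse is differentiable near `f a` except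
  -- perhaps at `f a`, where it is continuous: a removable singularity.
  have := (Complex.differentiableOn_compl_singleton_and_continuousAt_iff hmem).1
    ⟨?_, continuousAt_invFunOn hU hf hinj ha⟩
  · exact this.differentiableAt hmem
  · rintro _ ⟨⟨b, ⟨hbU, hb⟩, rfl⟩, hbne⟩
    have hba : b ≠ a := fun h => hbne (by simp [h])
    exact (hasDerivAt_invFunOn_of_deriv_ne_zero hU hf hinj hbU
      (hball b hb hba)).differentiableAt.differentiableWithinAt

/-- Chain rule for inverse ∘ `f` = identity. This is not circular: the inverse is differentiable
even at a possible critical value, by removability. -/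
theorem deriv_ne_zero_of_injOn (hU : IsOpen U) (hf : DifferentiableOn ℂ f U)
    (hinj : InjOn f U) {a : ℂ} (ha : a ∈ U) : deriv f a ≠ 0 := by
  intro h0
  have h1 := (differentiableAt_invFunOn hU hf hinj ha).hasDerivAt.comp a
    (hf.differentiableAt (hU.mem_nhds ha)).hasDerivAt
  have h2 : HasDerivAt (Function.invFunOn f U ∘ f) 1 a := by
    refine (hasDerivAt_id a).congr_of_eventuallyEq ?_
    filter_upwards [hU.mem_nhds ha] with z hz using hinj.leftInvOn_invFunOn hz
  simpa [h0] using h1.unique h2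

theorem differentiableOn_invFunOn (hU : IsOpen U) (hf : DifferentiableOn ℂ f U)
    (hinj : InjOn f U) : DifferentiableOn ℂ (Function.invFunOn f U) (f '' U) := by
  rintro _ ⟨a, ha, rfl⟩
  exact (differentiableAt_invFunOn hU hf hinj ha).differentiableWithinAt

/-- A holomorphic square root of a nonvanishing holomorphic function on a simply connected set. -/
theorem exists_differentiableOn_sq_eq (hUc : IsSimplyConnected U) (hU : IsOpen U)
    (hf : DifferentiableOn ℂ f U) (h0 : ∀ z ∈ U, f z ≠ 0) :
    ∃ k : ℂ → ℂ, DifferentiableOn ℂ k U ∧ ∀ z, k z ^ 2 = f z := by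
  obtain ⟨k, hkc, hk⟩ := Complex.exists_continuousOn_pow_eq hUc hU hf.continuousOn
    (by rintro ⟨z, hz, h⟩; exact h0 z hz h) two_ne_zero
  refine ⟨k, fun a ha => ?_, hk⟩
  have hka : k a ≠ 0 := fun h => h0 a ha (by rw [← hk, h]; simp)
  have hc : ContinuousAt k a := hkc.continuousAt (hU.mem_nhds ha)
  have hd := hasDerivAt_iff_tendsto_slope.1 (hf.differentiableAt (hU.mem_nhds ha)).hasDerivAt
  have hs : Tendsto (fun z => k z + k a) (𝓝[≠] a) (𝓝 (k a + k a)) :=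
    (hc.add continuousAt_const).mono_left nhdsWithin_le_nhds
  have hsne : k a + k a ≠ 0 := by simpa [← two_mul] using hka
  have : HasDerivAt k (deriv f a / (k a + k a)) a := by
    -- The slope of `f = k ^ 2` is the slope of `k` times `k z + k a`, and continuity of `k`
    -- controls the second factor.
    rw [hasDerivAt_iff_tendsto_slope]
    refine (hd.div hs hsne).congr' ?_
    filter_upwards [hs.eventually_ne hsne, self_mem_nhdsWithin] with z hz hza
    have hza' : z - a ≠ 0 := sub_ne_zero.2 hza
    simp only [slope_def_field, Pi.div_apply, ← hk]
    field_simp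
    ring
  exact this.differentiableAt.differentiableWithinAt

theorem Convex.isSimplyConnected {s : Set ℂ} (hs : Convex ℝ s) (hne : s.Nonempty) :
    IsSimplyConnected s := by
  have := hs.contractibleSpace hne
  exact inferInstanceAs (SimplyConnectedSpace s)

end Univalent

/-- Makes the inverse Riemann map a covering in the sense required by `IsDiskUniversalCovering`. -/
theorem Homeomorph.isCoveringMap_of_t2Space {X Y : Type*} [TopologicalSpace X]
    [TopologicalSpace Y] [T2Space X] (e : X ≃ₜ Y) : IsCoveringMap e := by
  rw [isCoveringMap_iff_isCoveringMapOn_univ]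
  refine e.isClosedMap.isCoveringMapOn_of_isLocalHomeomorphOn
    (fun x _ => (subsingleton_singleton.preimage e.injective).finite) ?_
  rw [preimage_univ, ← isLocalHomeomorph_iff_isLocalHomeomorphOn_univ]
  exact e.isLocalHomeomorph

/-! ### Disk automorphisms and the Schwarz-Pick lemma -/

section DiskAutomorphism

open ComplexConjugate

/-- The automorphism of the unit disk that sends `c` to `0`. -/
noncomputable def diskAut (c w : ℂ) : ℂ := (w - c) / (1 - conj c * w)

variable {c w : ℂ}

@[simp] theorem diskAut_self : diskAut c c = 0 := by simp [diskAut]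

@[simp] theorem diskAut_zero : diskAut c 0 = -c := by simp [diskAut]

theorem one_sub_conj_mul_ne_zero (hc : ‖c‖ < 1) (hw : ‖w‖ < 1) : 1 - conj c * w ≠ 0 := by
  intro h
  have h1 : ‖conj c * w‖ = 1 := by rw [← sub_eq_zero.1 h]; simp
  rw [norm_mul, RCLike.norm_conj] at h1
  nlinarith [norm_nonneg c, norm_nonneg w]

theorem norm_diskAut_lt_one (hc : ‖c‖ < 1) (hw : ‖w‖ < 1) : ‖diskAut c w‖ < 1 := by
  have h0 := one_sub_conj_mul_ne_zero hc hw
  rw [diskAut, norm_div, div_lt_one (norm_pos_iff.2 h0)]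
  refine lt_of_pow_lt_pow_left₀ 2 (norm_nonneg _) ?_
  have key : ‖1 - conj c * w‖ ^ 2 - ‖w - c‖ ^ 2 = (1 - ‖c‖ ^ 2) * (1 - ‖w‖ ^ 2) := by
    simp only [Complex.sq_norm, Complex.normSq_apply, Complex.sub_re, Complex.sub_im,
      Complex.mul_re, Complex.mul_im, Complex.conj_re, Complex.conj_im, Complex.one_re,
      Complex.one_im]
    ring
  have : 0 < (1 - ‖c‖ ^ 2) * (1 - ‖w‖ ^ 2) := by
    apply mul_pos <;> nlinarith [norm_nonneg c, norm_nonneg w]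
  linarith

theorem mapsTo_diskAut (hc : ‖c‖ < 1) : MapsTo (diskAut c) (ball 0 1) (ball 0 1) := by
  intro w hw
  rw [mem_ball_zero_iff] at *
  exact norm_diskAut_lt_one hc hw

theorem diskAut_neg_diskAut (hc : ‖c‖ < 1) (hw : ‖w‖ < 1) : diskAut (-c) (diskAut c w) = w := by
  have h0 := one_sub_conj_mul_ne_zero hc hw
  have h1 := one_sub_conj_mul_ne_zero hc hc
  have h3 : diskAut c w * (1 - conj c * w) = w - c := div_mul_cancel₀ _ h0
  have h2 : 1 - conj (-c) * diskAut c w = (1 - conj c * c) / (1 - conj c * w) := by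
    rw [eq_div_iff h0, map_neg]
    linear_combination conj c * h3
  rw [diskAut, h2, div_div_eq_mul_div, div_eq_iff h1]
  linear_combination h3

theorem injOn_diskAut (hc : ‖c‖ < 1) : InjOn (diskAut c) (ball 0 1) := by
  intro w hw v hv h
  rw [mem_ball_zero_iff] at hw hv
  rw [← diskAut_neg_diskAut hc hw, h, diskAut_neg_diskAut hc hv]

theorem hasDerivAt_diskAut (hc : ‖c‖ < 1) (hw : ‖w‖ < 1) :
    HasDerivAt (diskAut c) ((1 - conj c * c) / (1 - conj c * w) ^ 2) w := by
  have h0 := one_sub_conj_mul_ne_zero hc hw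
  have h1 : HasDerivAt (fun w => 1 - conj c * w) (-conj c) w := by
    simpa using ((hasDerivAt_id w).const_mul (conj c)).const_sub 1
  convert! ((hasDerivAt_id w).sub_const c).div h1 h0 using 1
  simp only [id]
  ring

theorem differentiableOn_diskAut (hc : ‖c‖ < 1) : DifferentiableOn ℂ (diskAut c) (ball 0 1) :=
  fun _ hw => (hasDerivAt_diskAut hc
    (mem_ball_zero_iff.1 hw)).differentiableAt.differentiableWithinAt

theorem hasDerivAt_diskAut_zero (hc : ‖c‖ < 1) :
    HasDerivAt (diskAut c) ((1 - ‖c‖ ^ 2 : ℝ) : ℂ) 0 := by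
  have h := hasDerivAt_diskAut hc (w := 0) (by simp)
  rw [← Complex.normSq_eq_conj_mul_self, Complex.normSq_eq_norm_sq] at h
  simpa using h

theorem hasDerivAt_diskAut_self (hc : ‖c‖ < 1) :
    HasDerivAt (diskAut c) (((1 - ‖c‖ ^ 2)⁻¹ : ℝ) : ℂ) c := by
  have h := hasDerivAt_diskAut hc hc
  have h0 := one_sub_conj_mul_ne_zero hc hc
  convert! h using 1
  rw [pow_two (1 - conj c * c), div_mul_cancel_left₀ h0, ← Complex.normSq_eq_conj_mul_self,
    Complex.normSq_eq_norm_sq]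
  push_cast
  rfl

/-- **Schwarz-Pick lemma** for a function vanishing at `ζ`. -/
theorem norm_deriv_mul_le_one_of_mapsTo {h : ℂ → ℂ} (hd : DifferentiableOn ℂ h (ball 0 1))
    (hm : MapsTo h (ball 0 1) (ball 0 1)) {ζ : ℂ} (hζ : ‖ζ‖ < 1) (h0 : h ζ = 0) :
    ‖deriv h ζ‖ * (1 - ‖ζ‖ ^ 2) ≤ 1 := by
  have hζ' : ‖-ζ‖ < 1 := by simpa
  have hd1 : DifferentiableOn ℂ (h ∘ diskAut (-ζ)) (ball 0 1) :=
    hd.comp (differentiableOn_diskAut hζ') (mapsTo_diskAut hζ')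
  have h1 : HasDerivAt (h ∘ diskAut (-ζ)) (deriv h ζ * ((1 - ‖-ζ‖ ^ 2 : ℝ) : ℂ)) 0 := by
    refine HasDerivAt.comp 0 ?_ (hasDerivAt_diskAut_zero hζ')
    simpa using (hd.differentiableAt (isOpen_ball.mem_nhds (mem_ball_zero_iff.2 hζ))).hasDerivAt
  have h2 := Complex.norm_deriv_le_one_of_mapsTo_ball hd1 (R := 1) (c := 0) ?_ one_pos
  · rw [h1.deriv, norm_mul, Complex.norm_real, norm_neg, Real.norm_of_nonneg] at h2
    · exact h2
    · nlinarith [norm_nonneg ζ]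
  · have : (h ∘ diskAut (-ζ)) 0 = 0 := by simp [h0]
    rw [this]
    exact fun w hw => ball_subset_closedBall (hm (mapsTo_diskAut hζ' hw))

end DiskAutomorphism

/-! ### Montel and Hurwitz theorems -/

section NormalFamilies

variable {U : Set ℂ} {F : ℕ → ℂ → ℂ} {G : ℂ → ℂ}

/-- A uniformly bounded sequence of holomorphic functions converges locally uniformly along any
ultrafilter. -/
theorem exists_tendstoLocallyUniformlyOn_ultrafilter (hU : IsOpen U)
    (hF : ∀ n, DifferentiableOn ℂ (F n) U) (hb : ∀ n, MapsTo (F n) U (ball 0 1))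
    (𝒰 : Ultrafilter ℕ) : ∃ G : ℂ → ℂ, TendstoLocallyUniformlyOn F G 𝒰 U := by
  have hlim : ∀ z, ∃ x, z ∈ U → Tendsto (fun n => F n z) 𝒰 (𝓝 x) := by
    intro z
    by_cases hz : z ∈ U
    · obtain ⟨x, -, hx⟩ := (isCompact_closedBall (0 : ℂ) 1).ultrafilter_le_nhds
        (𝒰.map (fun n => F n z)) (by
          rw [le_principal_iff]
          exact (Eventually.of_forall fun n => ball_subset_closedBall (hb n hz) :
            ∀ᶠ n in 𝒰, F n z ∈ closedBall 0 1))
      exact ⟨x, fun _ => hx⟩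
    · exact ⟨0, fun h => absurd h hz⟩
  choose G hG using hlim
  refine ⟨G, Metric.tendstoLocallyUniformlyOn_iff.2 fun ε hε x hx => ?_⟩
  obtain ⟨R, hR, hRU⟩ := Metric.isOpen_iff.1 hU x hx
  -- Equicontinuity from the Schwarz lemma: two values in the unit disk differ by at most 2.
  have hlip : ∀ n, ∀ y ∈ ball x R, dist (F n y) (F n x) ≤ 2 / R * dist y x := by
    intro n y hy
    refine Complex.dist_le_div_mul_dist_of_mapsTo_ball ((hF n).mono hRU) ?_ hy
    intro w hw
    have h1 := hb n (hRU hw)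
    have h2 := hb n hx
    rw [mem_ball_zero_iff] at h1 h2
    rw [mem_closedBall, dist_eq_norm]
    linarith [norm_sub_le (F n w) (F n x)]
  have hδ : 0 < min R (ε * R / 8) := by positivity
  refine ⟨ball x (min R (ε * R / 8)) ∩ U,
    inter_mem (mem_nhdsWithin_of_mem_nhds (ball_mem_nhds x hδ)) self_mem_nhdsWithin, ?_⟩
  filter_upwards [Metric.tendsto_nhds.1 (hG x hx) (ε / 4) (by positivity)] with n hn
  rintro y ⟨hy, hyU⟩
  have hyR : y ∈ ball x R := ball_subset_ball (min_le_left _ _) hy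
  have hsmall : ∀ m, dist (F m y) (F m x) ≤ ε / 4 := by
    intro m
    refine (hlip m y hyR).trans ?_
    have : dist y x ≤ ε * R / 8 := (mem_ball.1 hy).le.trans (min_le_right _ _)
    calc 2 / R * dist y x ≤ 2 / R * (ε * R / 8) := by gcongr
      _ = ε / 4 := by field_simp; norm_num
  have hGs : dist (G y) (G x) ≤ ε / 4 :=
    le_of_tendsto ((hG y hyU).dist (hG x hx)) (Eventually.of_forall hsmall)
  have h1 := dist_triangle4 (G y) (G x) (F n x) (F n y)
  have h2 := hsmall n
  rw [dist_comm] at h2 hn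
  linarith

/-- **Hurwitz's theorem**: a locally uniform limit of injective holomorphic functions is
injective or constant. -/
theorem injOn_of_tendstoLocallyUniformlyOn {φ : Filter ℕ} [φ.NeBot] (hU : IsOpen U)
    (hUc : IsPreconnected U) (hF : ∀ n, DifferentiableOn ℂ (F n) U) (hinj : ∀ n, InjOn (F n) U)
    (hlim : TendstoLocallyUniformlyOn F G φ U) {a : ℂ} (ha : a ∈ U) (hd : deriv G a ≠ 0) :
    InjOn G U := by
  have hG : DifferentiableOn ℂ G U := hlim.differentiableOn (Eventually.of_forall hF) hU
  intro x hx y hy hxy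
  by_contra hne
  have hiso : ∀ᶠ z in 𝓝[≠] x, G z - G x ≠ 0 := by
    have han : AnalyticAt ℂ (fun z => G z - G x) x :=
      (hG.analyticAt (hU.mem_nhds hx)).sub analyticAt_const
    refine han.eventually_eq_zero_or_eventually_ne_zero.resolve_left fun h => hd ?_
    have heq : EqOn G (fun _ => G x) U :=
      (hG.analyticOnNhd hU).eqOn_of_preconnected_of_eventuallyEq analyticOnNhd_const hUc hx
        (h.mono fun z hz => sub_eq_zero.1 hz)
    have : G =ᶠ[𝓝 a] fun _ => G x := heq.eventuallyEq_of_mem (hU.mem_nhds ha)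
    simpa using this.deriv_eq
  obtain ⟨r, hr, hball⟩ : ∃ r > 0, ∀ z ∈ closedBall x r,
      z ∈ U ∧ z ≠ y ∧ (z ≠ x → G z - G x ≠ 0) := by
    have := ((hU.eventually_mem hx).and ((eventually_ne_nhds hne).and
      (eventually_nhdsWithin_iff.1 hiso)))
    exact Metric.nhds_basis_closedBall.eventually_iff.1 this
  obtain ⟨w, hw, hmin⟩ := (isCompact_sphere x r).exists_isMinOn
    (NormedSpace.sphere_nonempty.2 hr.le)
    ((hG.continuousOn.mono fun z hz => (hball z (sphere_subset_closedBall hz)).1).sub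
      (continuousOn_const (c := G x))).norm
  set m := ‖G w - G x‖ with hm
  have hmpos : 0 < m := norm_pos_iff.2 ((hball w (sphere_subset_closedBall hw)).2.2
    (ne_of_mem_sphere hw hr.ne'))
  have hunif := Metric.tendstoUniformlyOn_iff.1
    ((tendstoLocallyUniformlyOn_iff_forall_isCompact hU).1 hlim (closedBall x r)
      (fun z hz => (hball z hz).1) (isCompact_closedBall x r)) (m / 8) (by positivity)
  have hy' := Metric.tendsto_nhds.1 (hlim.tendsto_at hy) (m / 8) (by positivity)
  obtain ⟨n, hn, hny⟩ := (hunif.and hy').exists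
  have hcl : closure (ball x r) ⊆ U := fun z hz => (hball z (closure_ball_subset_closedBall hz)).1
  -- On the circle `F n` stays at least `m / 2` away from `F n x`, so the image of the closed disk
  -- contains the ball of radius `m / 4` about `F n x`. That ball contains `F n y`, because `G y = G
  -- x`; but `y` is outside the disk.
  have hsub := DiffContOnCl.ball_subset_image_closedBall (f := F n) (z₀ := x) (r := r)
    (ε := m / 2) ((hF n).mono hcl).diffContOnCl hr ?_ ?_
  · have hnx := hn x (mem_closedBall_self hr.le)
    have : F n y ∈ ball (F n x) (m / 2 / 2) := by
      rw [mem_ball]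
      rw [hxy] at hnx
      linarith [dist_triangle (F n y) (G y) (F n x)]
    obtain ⟨z, hz, hzy⟩ := hsub this
    exact (hball z hz).2.1 (hinj n (hball z hz).1 hy hzy)
  · intro z hz
    have h1 : m ≤ ‖G z - G x‖ := hmin hz
    have h2 := hn z (sphere_subset_closedBall hz)
    have h3 := hn x (mem_closedBall_self hr.le)
    rw [← dist_eq_norm] at h1 ⊢
    rw [dist_comm] at h3
    linarith [dist_triangle4 (G z) (F n z) (F n x) (G x)]
  · have h1 : ∀ᶠ z in 𝓝[≠] x, F n z ≠ F n x := by
      filter_upwards [(hU.eventually_mem hx).filter_mono nhdsWithin_le_nhds,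
        self_mem_nhdsWithin] with z hz hzx
      exact fun h => hzx (hinj n hz hx h)
    exact h1.frequently.filter_mono nhdsWithin_le_nhds

end NormalFamilies

/-! ### Riemann mapping theorem -/

section RiemannMapping

/-- An injective holomorphic map of `U` into the unit disk that vanishes at `a`. -/
structure IsDiskEmbedding (F : ℂ → ℂ) (U : Set ℂ) (a : ℂ) : Prop where
  differentiableOn : DifferentiableOn ℂ F U
  injOn : InjOn F U
  mapsTo : MapsTo F U (ball 0 1)
  map_base : F a = 0

variable {U : Set ℂ} {F : ℂ → ℂ} {a : ℂ}

/-- A square root `k` of `z - c`, with `c` omitted, never takes both a value and its negative. It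
covers a ball about `k a`, hence omits the ball about `-k a`, and inversion there gives a bounded
function. -/
theorem exists_isDiskEmbedding (hU : IsOpen U) (hUc : IsSimplyConnected U) (hne : U ≠ univ)
    (ha : a ∈ U) : ∃ F, IsDiskEmbedding F U a := by
  obtain ⟨c, hc⟩ := (ne_univ_iff_exists_notMem U).1 hne
  have hq0 : ∀ z ∈ U, z - c ≠ 0 := fun z hz h => hc (sub_eq_zero.1 h ▸ hz)
  obtain ⟨k, hkd, hk⟩ := exists_differentiableOn_sq_eq hUc hU (f := fun z => z - c)
    (by fun_prop) hq0
  have hki : InjOn k U := fun x _ y _ hxy => by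
    simpa using (hk x).symm.trans ((congrArg (· ^ 2) hxy).trans (hk y))
  have hneg : ∀ x ∈ U, ∀ y ∈ U, k x ≠ -k y := by
    intro x hx y hy hxy
    have hxy' : x = y := by
      have := (hk x).symm.trans ((congrArg (· ^ 2) hxy).trans ((neg_sq (k y)).trans (hk y)))
      simpa using this
    subst hxy'
    refine hq0 x hx ?_
    rw [← hk, self_eq_neg.1 hxy]
    norm_num
  obtain ⟨ε, hε, hball⟩ := Metric.isOpen_iff.1
    (isOpen_image_of_injOn hU hkd hki hU Subset.rfl) (k a) (mem_image_of_mem k ha)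
  have hfar : ∀ z ∈ U, ε ≤ ‖k z + k a‖ := by
    intro z hz
    by_contra! hlt
    obtain ⟨w, hw, hwz⟩ := hball (show -k z ∈ ball (k a) ε by
      rw [mem_ball, dist_eq_norm, ← norm_neg]
      simpa [add_comm] using hlt)
    exact hneg w hw z hz hwz
  have hne0 : ∀ z ∈ U, k z + k a ≠ 0 := fun z hz => norm_pos_iff.1 (hε.trans_le (hfar z hz))
  set f : ℂ → ℂ := fun z => (ε / 2 : ℝ) / (k z + k a) with hf
  have hm : MapsTo f U (ball 0 1) := by
    intro z hz
    rw [mem_ball_zero_iff, hf, norm_div, Complex.norm_real, Real.norm_of_nonneg (by positivity),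
      div_lt_one (hε.trans_le (hfar z hz))]
    linarith [hfar z hz]
  have hi : InjOn f U := by
    intro x hx y hy hxy
    have hε' : ((ε / 2 : ℝ) : ℂ) ≠ 0 := by exact_mod_cast (by positivity : ε / 2 ≠ 0)
    simp only [hf] at hxy
    rw [div_eq_div_iff (hne0 x hx) (hne0 y hy)] at hxy
    exact hki hx hy (add_right_cancel (mul_left_cancel₀ hε' hxy)).symm
  have hd : DifferentiableOn ℂ f U :=
    (differentiableOn_const _).div (hkd.add_const _) hne0
  have hfa : ‖f a‖ < 1 := mem_ball_zero_iff.1 (hm ha)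
  exact ⟨diskAut (f a) ∘ f, (differentiableOn_diskAut hfa).comp hd hm,
    (injOn_diskAut hfa).comp hi hm, (mapsTo_diskAut hfa).comp hm, by simp⟩

/-- Cauchy estimates bound the derivatives, and a maximizing sequence converges along an
ultrafilter. The limit has nonzero derivative, so it is injective by Hurwitz; being open, it maps
into the open disk and not merely the closed one. -/
theorem exists_isDiskEmbedding_isMax (hU : IsOpen U) (hUc : IsSimplyConnected U)
    (hne : U ≠ univ) (ha : a ∈ U) : ∃ F, IsDiskEmbedding F U a ∧
      ∀ G, IsDiskEmbedding G U a → ‖deriv G a‖ ≤ ‖deriv F a‖ := by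
  set S : Set ℝ := {x | ∃ G, IsDiskEmbedding G U a ∧ ‖deriv G a‖ = x} with hS
  obtain ⟨F₀, hF₀⟩ := exists_isDiskEmbedding hU hUc hne ha
  have hSne : S.Nonempty := ⟨_, F₀, hF₀, rfl⟩
  obtain ⟨R, hR, hRU⟩ := Metric.isOpen_iff.1 hU a ha
  have hSb : BddAbove S := by
    refine ⟨1 / R, ?_⟩
    rintro _ ⟨G, hG, rfl⟩
    refine Complex.norm_deriv_le_div_of_mapsTo_ball (hG.differentiableOn.mono hRU) ?_ hR
    rw [hG.map_base]
    exact fun z hz => ball_subset_closedBall (hG.mapsTo (hRU hz))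
  obtain ⟨u, -, hu, huS⟩ := exists_seq_tendsto_sSup hSne hSb
  choose G hG hGu using huS
  obtain ⟨H, hH⟩ := exists_tendstoLocallyUniformlyOn_ultrafilter hU
    (fun n => (hG n).differentiableOn) (fun n => (hG n).mapsTo) (hyperfilter ℕ)
  have hHd : DifferentiableOn ℂ H U :=
    hH.differentiableOn (Eventually.of_forall fun n => (hG n).differentiableOn) hU
  have hmax : ‖deriv H a‖ = sSup S := by
    have h1 : Tendsto (fun n => ‖deriv (G n) a‖) (hyperfilter ℕ) (𝓝 ‖deriv H a‖) :=
      ((hH.deriv (Eventually.of_forall fun n => (hG n).differentiableOn) hU).tendsto_at ha).norm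
    simp only [hGu] at h1
    exact tendsto_nhds_unique h1 (hu.mono_left Nat.hyperfilter_le_atTop)
  have hpos : 0 < sSup S :=
    (norm_pos_iff.2 (deriv_ne_zero_of_injOn hU hF₀.differentiableOn hF₀.injOn ha)).trans_le
      (le_csSup hSb ⟨F₀, hF₀, rfl⟩)
  have hinj : InjOn H U := injOn_of_tendstoLocallyUniformlyOn hU
    hUc.isPathConnected.isConnected.isPreconnected (fun n => (hG n).differentiableOn)
    (fun n => (hG n).injOn) hH ha (norm_pos_iff.1 (hmax ▸ hpos))
  refine ⟨H, ⟨hHd, hinj, ?_, ?_⟩, fun G hG => hmax ▸ le_csSup hSb ⟨G, hG, rfl⟩⟩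
  · have hsub : H '' U ⊆ closedBall 0 1 := by
      rintro _ ⟨z, hz, rfl⟩
      exact isClosed_closedBall.mem_of_tendsto (hH.tendsto_at hz)
        (Eventually.of_forall fun n => ball_subset_closedBall ((hG n).mapsTo hz))
    have := (isOpen_image_of_injOn hU hHd hinj hU Subset.rfl).subset_interior_iff.2 hsub
    rw [interior_closedBall _ one_ne_zero] at this
    exact mapsTo_iff_image_subset.2 this
  · refine tendsto_nhds_unique (hH.tendsto_at ha) ?_
    simp only [(hG _).map_base]
    exact tendsto_const_nhds

/-- If a disk embedding is not onto, there is one with a larger derivative at the base point. -/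
theorem IsDiskEmbedding.exists_norm_deriv_lt (hF : IsDiskEmbedding F U a) (hU : IsOpen U)
    (hUc : IsSimplyConnected U) (ha : a ∈ U) {c : ℂ} (hc : ‖c‖ < 1) (hcF : c ∉ F '' U) :
    ∃ G, IsDiskEmbedding G U a ∧ ‖deriv F a‖ < ‖deriv G a‖ := by
  have hc0 : 0 < ‖c‖ := norm_pos_iff.2 fun h => hcF ⟨a, ha, by rw [hF.map_base, h]⟩
  have hmem : ∀ z ∈ U, ‖F z‖ < 1 := fun z hz => mem_ball_zero_iff.1 (hF.mapsTo hz)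
  have hqd : DifferentiableOn ℂ (diskAut c ∘ F) U :=
    (differentiableOn_diskAut hc).comp hF.differentiableOn hF.mapsTo
  have hqi : InjOn (diskAut c ∘ F) U := (injOn_diskAut hc).comp hF.injOn hF.mapsTo
  have hq0 : ∀ z ∈ U, (diskAut c ∘ F) z ≠ 0 := by
    intro z hz h
    refine hcF ⟨z, hz, injOn_diskAut hc (hF.mapsTo hz) (mem_ball_zero_iff.2 hc) ?_⟩
    rw [diskAut_self]
    exact h
  obtain ⟨k, hkd, hk⟩ := exists_differentiableOn_sq_eq hUc hU hqd hq0
  have hkm : MapsTo k U (ball 0 1) := by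
    intro z hz
    have h1 : ‖k z‖ ^ 2 < 1 := by
      rw [← norm_pow, hk]
      exact norm_diskAut_lt_one hc (hmem z hz)
    rw [mem_ball_zero_iff]
    nlinarith [norm_nonneg (k z)]
  have hki : InjOn k U := fun x hx y hy hxy => hqi hx hy (by rw [← hk, ← hk, hxy])
  have hb : ‖k a‖ < 1 := mem_ball_zero_iff.1 (hkm ha)
  have hb2 : ‖k a‖ ^ 2 = ‖c‖ := by
    rw [← norm_pow, hk]
    simp [hF.map_base]
  refine ⟨diskAut (k a) ∘ k, ⟨(differentiableOn_diskAut hb).comp hkd hkm,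
    (injOn_diskAut hb).comp hki hkm, (mapsTo_diskAut hb).comp hkm, by simp⟩, ?_⟩
  have hka := (hkd.differentiableAt (hU.mem_nhds ha)).hasDerivAt
  have hFa := (hF.differentiableOn.differentiableAt (hU.mem_nhds ha)).hasDerivAt
  have h1 : HasDerivAt (diskAut c ∘ F) (((1 - ‖c‖ ^ 2 : ℝ) : ℂ) * deriv F a) a := by
    refine HasDerivAt.comp a ?_ hFa
    rw [hF.map_base]
    exact hasDerivAt_diskAut_zero hc
  have h2 : HasDerivAt (diskAut c ∘ F) (2 * k a * deriv k a) a := by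
    have := hka.fun_pow 2
    rw [show (fun z => k z ^ 2) = diskAut c ∘ F from funext hk] at this
    simpa using this
  have h3 : HasDerivAt (diskAut (k a) ∘ k) ((((1 - ‖k a‖ ^ 2)⁻¹ : ℝ) : ℂ) * deriv k a) a :=
    HasDerivAt.comp a (hasDerivAt_diskAut_self hb) hka
  have h4 := congrArg norm (h1.unique h2)
  have hFpos : 0 < ‖deriv F a‖ :=
    norm_pos_iff.2 (deriv_ne_zero_of_injOn hU hF.differentiableOn hF.injOn ha)
  have hpos1 : 0 < 1 - ‖k a‖ ^ 2 := by rw [hb2]; linarith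
  have hpos2 : 0 < 1 - ‖c‖ ^ 2 := by nlinarith
  rw [norm_mul, norm_mul, norm_mul, Complex.norm_real, Real.norm_of_nonneg hpos2.le,
    Complex.norm_ofNat] at h4
  rw [h3.deriv, norm_mul, Complex.norm_real, Real.norm_of_nonneg (by positivity),
    inv_mul_eq_div, lt_div_iff₀ hpos1]
  have hkpos : 0 < ‖k a‖ := by
    rcases (norm_nonneg (k a)).eq_or_lt with h | h
    · rw [← h] at hb2; norm_num at hb2; exact absurd hb2.symm hc0.ne'
    · exact h
  -- With `t = ‖k a‖`, the relation `h4` reads `|F'| (1 - t⁴) = 2 t |k'|`. Hence `2 t (|k'| - |F'|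
  -- (1 - t²))` is exactly this quantity.
  have h5 : 0 < ‖deriv F a‖ * (1 - ‖k a‖ ^ 2) * (1 - ‖k a‖) ^ 2 := by
    have : 0 < 1 - ‖k a‖ := by linarith
    positivity
  rw [← hb2] at h4
  nlinarith

/-- The **Riemann mapping theorem**. -/
theorem exists_isDiskEmbedding_image_eq (hU : IsOpen U) (hUc : IsSimplyConnected U)
    (hne : U ≠ univ) (ha : a ∈ U) : ∃ F, IsDiskEmbedding F U a ∧ F '' U = ball 0 1 := by
  obtain ⟨F, hF, hmax⟩ := exists_isDiskEmbedding_isMax hU hUc hne ha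
  refine ⟨F, hF, hF.mapsTo.image_subset.antisymm fun c hc => ?_⟩
  by_contra hcF
  obtain ⟨G, hG, hlt⟩ := hF.exists_norm_deriv_lt hU hUc ha (mem_ball_zero_iff.1 hc) hcF
  exact (hmax G hG).not_gt hlt

/-- A Riemann map from the disk, together with its inverse. -/
theorem exists_diskParametrization (hU : IsOpen U) (hUc : IsSimplyConnected U)
    (hne : U ≠ univ) (ha : a ∈ U) : ∃ F p : ℂ → ℂ, IsDiskEmbedding F U a ∧
      DifferentiableOn ℂ p (ball 0 1) ∧ MapsTo p (ball 0 1) U ∧ LeftInvOn p F U ∧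
      LeftInvOn F p (ball 0 1) ∧ IsDiskUniversalCovering p U := by
  obtain ⟨F, hF, him⟩ := exists_isDiskEmbedding_image_eq hU hUc hne ha
  set p := Function.invFunOn F U with hp
  have hpd : DifferentiableOn ℂ p (ball 0 1) := by
    rw [← him]
    exact differentiableOn_invFunOn hU hF.differentiableOn hF.injOn
  have hpF : LeftInvOn p F U := hF.injOn.leftInvOn_invFunOn
  have hm : MapsTo p (ball 0 1) U := fun w hw =>
    Function.invFunOn_mem (show w ∈ F '' U by rwa [him])
  have hFp : LeftInvOn F p (ball 0 1) := fun w hw =>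
    Function.invFunOn_eq (show w ∈ F '' U by rwa [him])
  refine ⟨F, p, hF, hpd, hm, hpF, hFp, hpd, fun z hz => ⟨F z, hF.mapsTo hz, hpF hz⟩, hm, ?_⟩
  let e : ball (0 : ℂ) 1 ≃ₜ U :=
    { toFun := hm.restrict
      invFun := hF.mapsTo.restrict
      left_inv := fun w => Subtype.ext (hFp w.2)
      right_inv := fun z => Subtype.ext (hpF z.2)
      continuous_toFun := hpd.continuousOn.mapsToRestrict hm
      continuous_invFun := hF.differentiableOn.continuousOn.mapsToRestrict hF.mapsTo }
  exact e.isCoveringMap_of_t2Space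

end RiemannMapping

/-! ### Polar integration and area of images -/

section Area

open MeasureTheory Real

/-- The half-open annulus centered at the origin. -/
def annulus (r ρ : ℝ) : Set ℂ := {z | ‖z‖ ∈ Ioc r ρ}

theorem measurableSet_annulus (r ρ : ℝ) : MeasurableSet (annulus r ρ) :=
  continuous_norm.measurable measurableSet_Ioc

/-- Integration over an annulus in polar coordinates. -/
theorem setIntegral_annulus {r ρ : ℝ} (hr : 0 ≤ r) (hrρ : r ≤ ρ) {g : ℂ → ℝ}
    (hg : ContinuousOn g {z | ‖z‖ ∈ Icc r ρ}) :
    ∫ z in annulus r ρ, g z = ∫ t in r..ρ, 2 * π * t * circleAverage g 0 t := by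
  have hpolar : ∀ p : ℝ × ℝ, Complex.polarCoord.symm p = circleMap 0 p.1 p.2 := by
    intro p
    rw [Complex.polarCoord_symm_apply, circleMap_zero, Complex.exp_mul_I, Complex.ofReal_cos,
      Complex.ofReal_sin]
  have hcont : ContinuousOn (fun p : ℝ × ℝ => p.1 * g (circleMap 0 p.1 p.2))
      (Icc r ρ ×ˢ Icc (-π) π) := by
    refine continuousOn_fst.mul (hg.comp ?_ ?_)
    · simp only [circleMap]
      fun_prop
    · rintro ⟨t, θ⟩ ⟨ht, -⟩
      have h0 : 0 ≤ t := hr.trans ht.1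
      simpa [abs_of_nonneg h0] using ht
  have hint : IntegrableOn (fun p : ℝ × ℝ => p.1 * g (circleMap 0 p.1 p.2))
      (Ioc r ρ ×ˢ Ioo (-π) π) (volume.prod volume) :=
    (hcont.integrableOn_compact (isCompact_Icc.prod isCompact_Icc)).mono_set
      (prod_mono Ioc_subset_Icc_self Ioo_subset_Icc_self)
  rw [← integral_indicator (measurableSet_annulus r ρ), ← Complex.integral_comp_polarCoord_symm]
  have h1 : ∀ p ∈ polarCoord.target, p.1 • (annulus r ρ).indicator g (Complex.polarCoord.symm p) =
      (Ioc r ρ ×ˢ Ioo (-π) π).indicator (fun p : ℝ × ℝ => p.1 * g (circleMap 0 p.1 p.2)) p := by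
    rintro ⟨t, θ⟩ hp
    rw [polarCoord_target] at hp
    have h0 : 0 < t := hp.1
    have hθ := hp.2
    rw [hpolar]
    by_cases ht : t ∈ Ioc r ρ
    · rw [indicator_of_mem, indicator_of_mem, smul_eq_mul]
      · exact ⟨ht, hθ⟩
      · simpa [annulus, abs_of_pos h0] using ht
    · rw [indicator_of_notMem, indicator_of_notMem, smul_zero]
      · exact fun h => ht h.1
      · simpa [annulus, abs_of_pos h0] using ht
  rw [setIntegral_congr_fun
      (by rw [polarCoord_target]; exact measurableSet_Ioi.prod measurableSet_Ioo) h1,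
    setIntegral_indicator (measurableSet_Ioc.prod measurableSet_Ioo), polarCoord_target,
    prod_inter_prod, inter_self, inter_eq_self_of_subset_right
      (fun t ht => mem_Ioi.2 (hr.trans_lt ht.1)),
    Measure.volume_eq_prod, setIntegral_prod _ hint, intervalIntegral.integral_of_le hrρ]
  refine setIntegral_congr_fun measurableSet_Ioc fun t _ => ?_
  simp only
  rw [integral_const_mul, circleAverage_eq_integral_add (-π),
    intervalIntegral.integral_comp_add_right (fun θ => g (circleMap 0 t θ)),
    ← integral_Ioc_eq_integral_Ioo, ← intervalIntegral.integral_of_le (by linarith [pi_pos])]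
  rw [show (0 : ℝ) + -π = -π by ring, show 2 * π + -π = π by ring, smul_eq_mul]
  field_simp

/-- The area of the image of a set under an injective holomorphic function. -/
theorem volume_real_image_eq {s : Set ℂ} {f f' : ℂ → ℂ} (hs : MeasurableSet s)
    (hf : ∀ z ∈ s, HasDerivAt f (f' z) z) (hinj : InjOn f s) :
    volume.real (f '' s) = ∫ z in s, ‖f' z‖ ^ 2 := by
  have h := integral_image_eq_integral_abs_det_fderiv_smul (μ := volume) (F := ℝ) hs
    (fun z hz => ((hf z hz).hasFDerivAt.restrictScalars ℝ).hasFDerivWithinAt) hinj (fun _ => 1)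
  simp only [integral_const, MeasurableSet.univ, measureReal_restrict_apply, univ_inter,
    smul_eq_mul, mul_one] at h
  rw [h]
  refine setIntegral_congr_fun hs fun z _ => ?_
  -- The real Jacobian of multiplication by a complex number is its norm from ℂ to ℝ.
  have hdet : ((ContinuousLinearMap.toSpanSingleton ℂ (f' z)).restrictScalars ℝ).det =
      ‖f' z‖ ^ 2 := by
    rw [← Complex.normSq_eq_norm_sq, ← Algebra.norm_complex_apply, ContinuousLinearMap.det]
    have := LinearMap.det_restrictScalars (R := ℝ)
      (f := (ContinuousLinearMap.toSpanSingleton ℂ (f' z) : ℂ →ₗ[ℂ] ℂ))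
    simpa using this
  rw [hdet, abs_of_nonneg (by positivity)]

end Area

/-! ### Lower bounds for area integrals by the mean value property -/

section Koebe

open MeasureTheory Real ComplexConjugate

theorem circleAverage_re_eq {h : ℂ → ℂ} (hd : DifferentiableOn ℂ h (ball 0 1)) {t : ℝ}
    (ht0 : 0 < t) (ht1 : t < 1) : circleAverage (fun z => (h z).re) 0 t = (h 0).re := by
  have hsub : closure (ball (0 : ℂ) |t|) ⊆ ball 0 1 :=
    closure_ball_subset_closedBall.trans (closedBall_subset_ball (by rwa [abs_of_pos ht0]))
  have h1 : circleAverage h 0 t = h 0 := (hd.mono hsub).diffContOnCl.circleAverage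
  have hci : CircleIntegrable h 0 t := by
    refine ContinuousOn.circleIntegrable ht0.le (hd.continuousOn.mono fun z hz => ?_)
    rw [mem_sphere_zero_iff_norm] at hz
    rwa [mem_ball_zero_iff, hz]
  rw [← h1]
  exact Complex.reCLM.circleAverage_comp_comm hci

theorem closedAnnulus_subset_ball {r ρ : ℝ} (hρ : ρ < 1) :
    {z : ℂ | ‖z‖ ∈ Icc r ρ} ⊆ ball 0 1 :=
  fun _ hz => mem_ball_zero_iff.2 (hz.2.trans_lt hρ)

theorem isCompact_closedAnnulus (r ρ : ℝ) : IsCompact {z : ℂ | ‖z‖ ∈ Icc r ρ} := by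
  refine (isCompact_closedBall (0 : ℂ) ρ).of_isClosed_subset
    (isClosed_Icc.preimage continuous_norm) fun z hz => ?_
  exact mem_closedBall_zero_iff.2 hz.2

theorem integrableOn_annulus {r ρ : ℝ} {g : ℂ → ℝ} (hg : ContinuousOn g {z | ‖z‖ ∈ Icc r ρ}) :
    IntegrableOn g (annulus r ρ) :=
  (hg.integrableOn_compact (isCompact_closedAnnulus r ρ)).mono_set
    fun _ hz => Ioc_subset_Icc_self hz

/-- A holomorphic function has squared `L²` norm at least that of its constant term. -/
theorem le_setIntegral_annulus_norm_sq {w : ℂ → ℂ} (hw : DifferentiableOn ℂ w (ball 0 1))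
    {ρ : ℝ} (hρ0 : 0 ≤ ρ) (hρ : ρ < 1) :
    π * ρ ^ 2 * ‖w 0‖ ^ 2 ≤ ∫ z in annulus 0 ρ, ‖w z‖ ^ 2 := by
  -- `Re K` is a harmonic minorant of `|w|²`: the difference is `|w - w 0|²`. Its circle averages
  -- are `|w 0|²`, so no power series is needed.
  set K : ℂ → ℂ := fun z => (‖w 0‖ ^ 2 : ℝ) + 2 * conj (w 0) * (w z - w 0) with hK
  have hKd : DifferentiableOn ℂ K (ball 0 1) :=
    ((hw.sub_const _).const_mul _).const_add _
  have hwc : ContinuousOn w {z | ‖z‖ ∈ Icc 0 ρ} :=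
    hw.continuousOn.mono (closedAnnulus_subset_ball hρ)
  have hKc : ContinuousOn (fun z => (K z).re) {z | ‖z‖ ∈ Icc 0 ρ} :=
    Complex.continuous_re.comp_continuousOn
      (hKd.continuousOn.mono (closedAnnulus_subset_ball hρ))
  have h1 : ∫ z in annulus 0 ρ, (K z).re = π * ρ ^ 2 * ‖w 0‖ ^ 2 := by
    rw [setIntegral_annulus le_rfl hρ0 hKc]
    have : ∀ t ∈ uIcc 0 ρ, 2 * π * t * circleAverage (fun z => (K z).re) 0 t =
        2 * π * ‖w 0‖ ^ 2 * t := by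
      intro t ht
      rw [uIcc_of_le hρ0] at ht
      rcases ht.1.eq_or_lt with h | h
      · simp [← h]
      · rw [circleAverage_re_eq hKd h (ht.2.trans_lt hρ)]
        simp only [hK, sub_self, mul_zero, add_zero, Complex.ofReal_re]
        ring
    rw [intervalIntegral.integral_congr this, intervalIntegral.integral_const_mul, integral_id]
    ring
  rw [← h1]
  refine setIntegral_mono_on (integrableOn_annulus hKc) (integrableOn_annulus (hwc.norm.pow 2))
    (measurableSet_annulus 0 ρ) fun z _ => ?_
  have h2 : ‖w z‖ ^ 2 - (K z).re = ‖w z - w 0‖ ^ 2 := by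
    simp only [hK, Complex.sq_norm, Complex.normSq_apply, Complex.sub_re, Complex.sub_im,
      Complex.add_re, Complex.mul_re, Complex.mul_im, Complex.conj_re, Complex.conj_im,
      Complex.ofReal_re, Complex.re_ofNat, Complex.im_ofNat]
    ring
  linarith [sq_nonneg ‖w z - w 0‖]

/-- Lower bound for the area swept out by a function with a simple pole of residue `1`. -/
theorem le_setIntegral_annulus_norm_sub_sq {w : ℂ → ℂ} (hw : DifferentiableOn ℂ w (ball 0 1))
    {r ρ : ℝ} (hr0 : 0 < r) (hrρ : r ≤ ρ) (hρ : ρ < 1) :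
    π * (1 / r ^ 2 - 1 / ρ ^ 2) + π * (ρ ^ 2 - r ^ 2) * ‖w 0‖ ^ 2 ≤
      ∫ z in annulus r ρ, ‖-(z ^ 2)⁻¹ + w z‖ ^ 2 := by
  -- On `|z| = t` the conjugate of `z⁻²` is `z² / t⁴`, so the cross term is also the real part of a
  -- holomorphic function, vanishing at 0. Thus `Re (K t)` is a minorant on that circle with mean `1
  -- / t⁴ + |w 0|²`.
  set K : ℝ → ℂ → ℂ := fun t z => (1 / t ^ 4 + ‖w 0‖ ^ 2 : ℝ) + 2 * conj (w 0) * (w z - w 0) -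
    (2 / t ^ 4 : ℝ) * (z ^ 2 * w z) with hK
  have hKd : ∀ t, DifferentiableOn ℂ (K t) (ball 0 1) := fun t =>
    (((hw.sub_const _).const_mul _).const_add _).sub
      (((differentiableOn_id.pow 2).mul hw).const_mul _)
  have hwc : ContinuousOn w {z | ‖z‖ ∈ Icc r ρ} :=
    hw.continuousOn.mono (closedAnnulus_subset_ball hρ)
  have hne : ∀ z ∈ {z : ℂ | ‖z‖ ∈ Icc r ρ}, z ≠ 0 := fun z hz =>
    norm_pos_iff.1 (hr0.trans_le hz.1)
  have hKc : ContinuousOn (fun z => (K ‖z‖ z).re) {z | ‖z‖ ∈ Icc r ρ} := by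
    have hn : ∀ z ∈ {z : ℂ | ‖z‖ ∈ Icc r ρ}, ‖z‖ ^ 4 ≠ 0 := fun z hz =>
      pow_ne_zero _ (norm_ne_zero_iff.2 (hne z hz))
    have hn4 : ContinuousOn (fun z : ℂ => ‖z‖ ^ 4) {z : ℂ | ‖z‖ ∈ Icc r ρ} := by fun_prop
    have c1 : ContinuousOn (fun z : ℂ => 1 / ‖z‖ ^ 4) {z : ℂ | ‖z‖ ∈ Icc r ρ} :=
      continuousOn_const.div hn4 hn
    have c2 : ContinuousOn (fun z : ℂ => 2 / ‖z‖ ^ 4) {z : ℂ | ‖z‖ ∈ Icc r ρ} :=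
      continuousOn_const.div hn4 hn
    refine Complex.continuous_re.comp_continuousOn ?_
    refine ((Complex.continuous_ofReal.comp_continuousOn (c1.add continuousOn_const)).add
      (continuousOn_const.mul (hwc.sub continuousOn_const))).sub
      ((Complex.continuous_ofReal.comp_continuousOn c2).mul
        ((continuousOn_id.pow 2).mul hwc))
  have hfc : ContinuousOn (fun z => ‖-(z ^ 2)⁻¹ + w z‖ ^ 2) {z | ‖z‖ ∈ Icc r ρ} :=
    ((((continuousOn_id.pow 2).inv₀ fun z hz => pow_ne_zero 2 (hne z hz)).neg.add hwc).norm).pow 2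
  have h1 : ∫ z in annulus r ρ, (K ‖z‖ z).re =
      π * (1 / r ^ 2 - 1 / ρ ^ 2) + π * (ρ ^ 2 - r ^ 2) * ‖w 0‖ ^ 2 := by
    rw [setIntegral_annulus hr0.le hrρ hKc]
    have : ∀ t ∈ uIcc r ρ, 2 * π * t * circleAverage (fun z => (K ‖z‖ z).re) 0 t =
        2 * π * (1 / t ^ 3 + ‖w 0‖ ^ 2 * t) := by
      intro t ht
      rw [uIcc_of_le hrρ] at ht
      have ht0 : 0 < t := hr0.trans_le ht.1
      have : circleAverage (fun z => (K ‖z‖ z).re) 0 t = circleAverage (fun z => (K t z).re) 0 t := by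
        refine circleAverage_congr_sphere fun z hz => ?_
        rw [mem_sphere_zero_iff_norm, abs_of_pos ht0] at hz
        simp only [hz]
      rw [this, circleAverage_re_eq (hKd t) ht0 (ht.2.trans_lt hρ)]
      have : (K t 0).re = 1 / t ^ 4 + ‖w 0‖ ^ 2 := by
        simp only [hK, sub_self, mul_zero, add_zero, ne_eq, OfNat.ofNat_ne_zero,
          not_false_eq_true, zero_pow, zero_mul, sub_zero, Complex.ofReal_re]
      rw [this]
      field_simp
    rw [intervalIntegral.integral_congr this]
    have hpos : ∀ t ∈ uIcc r ρ, t ≠ 0 := fun t ht => by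
      rw [uIcc_of_le hrρ] at ht
      exact (hr0.trans_le ht.1).ne'
    have hder : ∀ t ∈ uIcc r ρ, HasDerivAt (fun t => π * (‖w 0‖ ^ 2 * t ^ 2 - (t ^ 2)⁻¹))
        (2 * π * (1 / t ^ 3 + ‖w 0‖ ^ 2 * t)) t := by
      intro t ht
      have h0 := hpos t ht
      convert! (((hasDerivAt_pow 2 t).const_mul (‖w 0‖ ^ 2)).sub
        ((hasDerivAt_pow 2 t).fun_inv (pow_ne_zero 2 h0))).const_mul π using 1
      field_simp
      push_cast
      ring
    rw [intervalIntegral.integral_eq_sub_of_hasDerivAt hder]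
    · ring
    · refine ContinuousOn.intervalIntegrable ?_
      refine continuousOn_const.mul ((continuousOn_const.div (by fun_prop)
        fun t ht => pow_ne_zero 3 (hpos t ht)).add (by fun_prop))
  rw [← h1]
  refine setIntegral_mono_on (integrableOn_annulus hKc) (integrableOn_annulus hfc)
    (measurableSet_annulus r ρ) fun z hz => ?_
  have hz0 : z ≠ 0 := hne z (Ioc_subset_Icc_self hz)
  have hzn : (‖z‖ : ℝ) ≠ 0 := norm_ne_zero_iff.2 hz0
  have h3 : (z ^ 2)⁻¹ = (1 / ‖z‖ ^ 4 : ℝ) * conj (z ^ 2) := by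
    rw [Complex.inv_def, Complex.normSq_eq_norm_sq, norm_pow, mul_comm, one_div, ← pow_mul]
  have h4 : ‖(z ^ 2)⁻¹‖ ^ 2 = 1 / ‖z‖ ^ 4 := by
    rw [norm_inv, norm_pow]
    field_simp
  have h5 : ‖-(z ^ 2)⁻¹ + w z‖ ^ 2 =
      ‖(z ^ 2)⁻¹‖ ^ 2 + ‖w z‖ ^ 2 - 2 * (conj ((z ^ 2)⁻¹) * w z).re := by
    simp only [Complex.sq_norm, Complex.normSq_apply, Complex.neg_re, Complex.neg_im,
      Complex.add_re, Complex.add_im, Complex.mul_re, Complex.conj_re, Complex.conj_im]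
    ring
  have h6 : (conj ((z ^ 2)⁻¹) * w z).re = 1 / ‖z‖ ^ 4 * (z ^ 2 * w z).re := by
    rw [h3, map_mul, Complex.conj_conj, Complex.conj_ofReal, mul_assoc, Complex.re_ofReal_mul]
  have h7 : (K ‖z‖ z).re = 1 / ‖z‖ ^ 4 + ‖w 0‖ ^ 2 + 2 * (conj (w 0) * (w z - w 0)).re -
      2 * (1 / ‖z‖ ^ 4 * (z ^ 2 * w z).re) := by
    simp only [hK]
    rw [Complex.sub_re, Complex.add_re, Complex.ofReal_re, Complex.re_ofReal_mul, mul_assoc 2,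
      show (2 : ℂ) = ((2 : ℝ) : ℂ) by norm_num, Complex.re_ofReal_mul]
    ring
  have h8 : ‖w z‖ ^ 2 - ‖w 0‖ ^ 2 - 2 * (conj (w 0) * (w z - w 0)).re = ‖w z - w 0‖ ^ 2 := by
    simp only [Complex.sq_norm, Complex.normSq_apply, Complex.sub_re, Complex.sub_im,
      Complex.mul_re, Complex.conj_re, Complex.conj_im]
    ring
  rw [h7, h5, h6, h4]
  linarith [sq_nonneg ‖w z - w 0‖]

end Koebe

/-! ### Weak area theorem and Koebe distortion -/

section KoebeDistortion

open MeasureTheory Real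

/-- A weak form of the **area theorem**: the complement of the image of an injective function
`z⁻¹ + b z` on the punctured disk has bounded area. -/
theorem volume_real_le_of_disjoint_image {b : ℂ → ℂ} (hb : DifferentiableOn ℂ b (ball 0 1))
    (hb0 : b 0 = 0) (hinj : InjOn (fun z => z⁻¹ + b z) (ball 0 1 \ {0})) {V : Set ℂ}
    (hVm : MeasurableSet V) (hVb : Bornology.IsBounded V)
    (hdisj : Disjoint V ((fun z => z⁻¹ + b z) '' (ball 0 1 \ {0}))) :
    volume.real V ≤ 9 * π := by
  set C : ℝ := ‖deriv b 0‖ + 1 with hC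
  have hC1 : 1 ≤ C := by linarith [norm_nonneg (deriv b 0)]
  obtain ⟨s, hs, hsb⟩ : ∃ s > 0, ∀ z ∈ ball (0 : ℂ) s, ‖b z‖ ≤ C * ‖z‖ := by
    have h1 := (hb.differentiableAt (isOpen_ball.mem_nhds (mem_ball_self one_pos))).hasDerivAt
    have h2 := (hasDerivAt_iff_isLittleO.1 h1).def one_pos
    obtain ⟨s, hs, h3⟩ := Metric.eventually_nhds_iff_ball.1 h2
    refine ⟨s, hs, fun z hz => ?_⟩
    have h4 := h3 z hz
    simp only [hb0, sub_zero, smul_eq_mul, one_mul] at h4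
    calc ‖b z‖ = ‖(b z - z * deriv b 0) + z * deriv b 0‖ := by ring_nf
      _ ≤ ‖b z - z * deriv b 0‖ + ‖z * deriv b 0‖ := norm_add_le _ _
      _ ≤ ‖z‖ + ‖z‖ * ‖deriv b 0‖ := by rw [norm_mul]; gcongr
      _ = C * ‖z‖ := by rw [hC]; ring
  set s' : ℝ := min (s / 2) (1 / C) with hs'
  have hs'0 : 0 < s' := by positivity
  have hs's : s' < s := (min_le_left _ _).trans_lt (by linarith)
  have hs'C : s' * C ≤ 1 := by
    calc s' * C ≤ 1 / C * C := by gcongr; exact min_le_right _ _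
      _ = 1 := by field_simp
  obtain ⟨B, hB⟩ := (isCompact_closedBall (0 : ℂ) (3 / 4)).exists_bound_of_continuousOn
    (hb.continuousOn.mono (closedBall_subset_ball (by norm_num)))
  have hB0 : 0 ≤ B := (norm_nonneg _).trans (hB 0 (by simp; norm_num))
  obtain ⟨M, hM0, hM⟩ := hVb.exists_pos_norm_le
  -- The inner radius `r = 1 / N` is so small that the disk of radius `1 / r + C r` contains both
  -- `V` and the image of the annulus.
  set N : ℝ := 1 / s' + B + M + C + 2 with hN
  have hs'1 : 0 < 1 / s' := by positivity
  have hN2 : 2 ≤ N := by rw [hN]; linarith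
  set r : ℝ := 1 / N with hr
  have hr0 : 0 < r := by positivity
  have hrN : 1 / r = N := by rw [hr, one_div_one_div]
  have hr12 : r ≤ 1 / 2 := by rw [hr]; gcongr
  have hCr : C * r ≤ 1 := by
    rw [hr, mul_one_div, div_le_one (by linarith), hN]
    linarith
  set φ : ℂ → ℂ := fun z => z⁻¹ + b z with hφ
  have hsub : annulus r (3 / 4) ⊆ ball 0 1 \ {0} := fun z hz => by
    refine ⟨mem_ball_zero_iff.2 (hz.2.trans_lt (by norm_num)), fun h => ?_⟩
    rw [mem_singleton_iff] at h
    have := hz.1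
    rw [h, norm_zero] at this
    linarith
  have hsize : ∀ z ∈ annulus r (3 / 4), ‖φ z‖ ≤ 1 / r + C * r := by
    intro z hz
    have hz0 : 0 < ‖z‖ := hr0.trans hz.1
    have h1 : ‖φ z‖ ≤ 1 / ‖z‖ + ‖b z‖ := by
      rw [one_div, ← norm_inv]
      exact norm_add_le _ _
    by_cases hzs : ‖z‖ < s'
    · have h2 := hsb z (mem_ball_zero_iff.2 (hzs.trans hs's))
      have h3 : ‖z‖ * C ≤ 1 := (mul_le_mul_of_nonneg_right hzs.le (by linarith)).trans hs'C
      -- Near 0 the bound `1 / x + C x` is largest at the inner radius.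
      have h4 : 1 / r + C * r - (1 / ‖z‖ + C * ‖z‖) =
          (‖z‖ - r) * (1 - r * (‖z‖ * C)) / (r * ‖z‖) := by
        field_simp
        ring
      have h5 : 0 ≤ (‖z‖ - r) * (1 - r * (‖z‖ * C)) / (r * ‖z‖) := by
        refine div_nonneg (mul_nonneg (sub_nonneg.2 hz.1.le) ?_) (by positivity)
        nlinarith [mul_nonneg hz0.le (by linarith : (0 : ℝ) ≤ C)]
      linarith
    · have h2 := hB z (mem_closedBall_zero_iff.2 hz.2)
      have h3 : 1 / ‖z‖ ≤ 1 / s' := one_div_le_one_div_of_le hs'0 (not_lt.1 hzs)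
      have h4 : 0 ≤ C * r := by positivity
      rw [hrN, hN]
      linarith
  have hunion : V ∪ φ '' annulus r (3 / 4) ⊆ closedBall 0 (1 / r + C * r) := by
    rintro z (hz | ⟨x, hx, rfl⟩)
    · rw [mem_closedBall_zero_iff]
      have h4 : 0 ≤ C * r := by positivity
      refine (hM z hz).trans ?_
      rw [hrN, hN]
      linarith
    · exact mem_closedBall_zero_iff.2 (hsize x hx)
  have hder : ∀ z ∈ annulus r (3 / 4), HasDerivAt φ (-(z ^ 2)⁻¹ + deriv b z) z := fun z hz =>
    (hasDerivAt_inv (hsub hz).2).add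
      (hb.differentiableAt (isOpen_ball.mem_nhds (hsub hz).1)).hasDerivAt
  have harea := volume_real_image_eq (measurableSet_annulus r (3 / 4)) hder (hinj.mono hsub)
  have hlow := le_setIntegral_annulus_norm_sub_sq (hb.deriv isOpen_ball) hr0
    (by linarith : r ≤ 3 / 4) (by norm_num)
  rw [← harea] at hlow
  have hfin : volume (closedBall (0 : ℂ) (1 / r + C * r)) ≠ ⊤ := measure_closedBall_lt_top.ne
  have hup : volume.real (closedBall (0 : ℂ) (1 / r + C * r)) = π * (1 / r + C * r) ^ 2 := by
    rw [measureReal_def, Complex.volume_closedBall, ENNReal.toReal_mul, ENNReal.toReal_pow,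
      ENNReal.toReal_ofReal (by positivity)]
    simp [mul_comm]
  -- Two disjoint sets in one disk: the terms `π / r²` in the disk area and in `hlow` cancel,
  -- leaving a bound on `V`.
  have hadd : volume.real V + volume.real (φ '' annulus r (3 / 4)) ≤
      π * (1 / r + C * r) ^ 2 := by
    rw [← hup, ← measureReal_union' (hdisj.mono_right (image_mono hsub)) hVm
      (measure_ne_top_of_subset (subset_union_left.trans hunion) hfin)
      (measure_ne_top_of_subset (subset_union_right.trans hunion) hfin)]
    exact measureReal_mono hunion hfin
  have hx : 0 ≤ ‖deriv b 0‖ := norm_nonneg _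
  have hexp : π * (1 / r + C * r) ^ 2 = π * (1 / r ^ 2) + π * (2 * C + (C * r) ^ 2) := by
    field_simp
    ring
  rw [hexp] at hadd
  have hfinal : volume.real V ≤ π * (2 * C + (C * r) ^ 2 + 16 / 9 -
      (9 / 16 - r ^ 2) * ‖deriv b 0‖ ^ 2) := by
    nlinarith
  refine hfinal.trans ?_
  rw [mul_comm 9]
  refine mul_le_mul_of_nonneg_left ?_ pi_pos.le
  have h1 : (C * r) ^ 2 ≤ 1 := pow_le_one₀ (by positivity) hCr
  have h2 : r ^ 2 * ‖deriv b 0‖ ^ 2 ≤ 1 := by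
    refine le_trans ?_ h1
    rw [← mul_pow, mul_comm]
    gcongr
    linarith
  rw [hC] at h1 ⊢
  -- With `x = ‖deriv b 0‖`, the expression is at most `2 x - 9 x² / 16 + 4 + 16 / 9`, maximal at `x
  -- = 16 / 9` with value `4 + 32 / 9 < 9`.
  nlinarith [sq_nonneg (‖deriv b 0‖ - 16 / 9)]

/-- A holomorphic injective function on the disk whose range is disjoint from its negative does
not vary too fast. -/
theorem norm_deriv_le_of_add_ne_zero {k : ℂ → ℂ} (hk : DifferentiableOn ℂ k (ball 0 1))
    (hinj : InjOn k (ball 0 1)) (hadd : ∀ z ∈ ball (0 : ℂ) 1, ∀ w ∈ ball (0 : ℂ) 1, k z + k w ≠ 0) :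
    ‖deriv k 0‖ ≤ 4 * ‖k 0‖ := by
  have h0 : (0 : ℂ) ∈ ball (0 : ℂ) 1 := mem_ball_self one_pos
  have hnhds : ball (0 : ℂ) 1 ∈ 𝓝 0 := ball_mem_nhds 0 one_pos
  set A := deriv k 0 with hA
  have hA0 : A ≠ 0 := deriv_ne_zero_of_injOn isOpen_ball hk hinj h0
  have hk0 : k 0 ≠ 0 := fun h => hadd 0 h0 0 h0 (by rw [h, add_zero])
  set s := dslope k 0 with hs
  have hsd : DifferentiableOn ℂ s (ball 0 1) := (Complex.differentiableOn_dslope hnhds).2 hk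
  have hs0 : s 0 = A := dslope_same _ _
  have hsmul : ∀ z, z * s z = k z - k 0 := fun z => by
    simpa using sub_smul_dslope k 0 z
  have hsne : ∀ z ∈ ball (0 : ℂ) 1, s z ≠ 0 := by
    intro z hz h
    by_cases hz0 : z = 0
    · rw [hz0, hs0] at h
      exact hA0 h
    · refine hz0 (hinj hz h0 (sub_eq_zero.1 ?_))
      rw [← hsmul, h, mul_zero]
  -- Since `k z - k 0 = z s z`, one has `A / (k z - k 0) = 1 / z - dslope s 0 z / s z`; adding `e`
  -- makes the regular part `b` vanish at 0.
  set e := dslope s 0 0 / A with he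
  set b : ℂ → ℂ := fun z => e - dslope s 0 z / s z with hb
  have hbd : DifferentiableOn ℂ b (ball 0 1) :=
    (((Complex.differentiableOn_dslope hnhds).2 hsd).div hsd hsne).const_sub _
  have hb0 : b 0 = 0 := by simp only [hb, hs0, he, sub_self]
  have hφ : ∀ z ∈ ball (0 : ℂ) 1 \ {0}, z⁻¹ + b z = A / (k z - k 0) + e := by
    rintro z ⟨hz, hz0⟩
    have hz0' : z ≠ 0 := hz0
    have h1 : z * dslope s 0 z = s z - A := by
      simpa [hs0] using sub_smul_dslope s 0 z
    have h2 := hsne z hz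
    rw [← hsmul]
    simp only [hb]
    field_simp
    linear_combination -h1
  have hkne : ∀ z ∈ ball (0 : ℂ) 1 \ {0}, k z - k 0 ≠ 0 := fun z hz h =>
    hz.2 (hinj hz.1 h0 (sub_eq_zero.1 h))
  have hφinj : InjOn (fun z => z⁻¹ + b z) (ball 0 1 \ {0}) := by
    intro z hz w hw h
    simp only [hφ z hz, hφ w hw] at h
    have h1 := add_right_cancel h
    rw [div_eq_div_iff (hkne z hz) (hkne w hw)] at h1
    exact hinj hz.1 hw.1 (sub_left_injective (mul_left_cancel₀ hA0 h1).symm)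
  -- The Möbius map `u ↦ A / (u - k 0) + e` that carries `k` to `1/z + b z`, applied to `-k z`.
  set ψ : ℂ → ℂ := fun z => e - A / (k z + k 0) with hψ
  have hψc : ContinuousOn ψ (ball 0 1) :=
    continuousOn_const.sub (continuousOn_const.div (hk.continuousOn.add continuousOn_const)
      fun z hz => hadd z hz 0 h0)
  have hψinj : InjOn ψ (ball 0 1) := by
    intro z hz w hw h
    have h1 := sub_right_injective h
    rw [div_eq_div_iff (hadd z hz 0 h0) (hadd w hw 0 h0)] at h1
    exact hinj hz hw (add_right_cancel (mul_left_cancel₀ hA0 h1).symm)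
  have hsub : annulus 0 (3 / 4) ⊆ ball 0 1 := fun z hz =>
    mem_ball_zero_iff.2 (hz.2.trans_lt (by norm_num))
  have hder : ∀ z ∈ ball (0 : ℂ) 1, HasDerivAt ψ (A * deriv k z / (k z + k 0) ^ 2) z := by
    intro z hz
    have h1 := (hk.differentiableAt (isOpen_ball.mem_nhds hz)).hasDerivAt.add_const (k 0)
    convert! ((hasDerivAt_const z A).div h1 (hadd z hz 0 h0)).const_sub e using 1
    ring
  have hle := volume_real_le_of_disjoint_image hbd hb0 hφinj (V := ψ '' annulus 0 (3 / 4)) ?_ ?_ ?_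
  · rw [volume_real_image_eq (measurableSet_annulus _ _) (fun z hz => hder z (hsub hz))
      (hψinj.mono hsub)] at hle
    have hlow := le_setIntegral_annulus_norm_sq
      (w := fun z => A * deriv k z / (k z + k 0) ^ 2) (ρ := 3 / 4)
      (((hk.deriv isOpen_ball).const_mul A).div ((hk.add_const _).pow 2)
        fun z hz => pow_ne_zero 2 (hadd z hz 0 h0)) (by norm_num) (by norm_num)
    have h1 := hlow.trans hle
    rw [← hA, norm_div, norm_mul, norm_pow, ← two_mul, norm_mul, Complex.norm_ofNat] at h1
    have hkp : 0 < ‖k 0‖ := norm_pos_iff.2 hk0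
    -- The base is `|ψ' 0|`, and the areas give `(9 / 16) π |ψ' 0|² ≤ 9 π`.
    have h2 : (‖A‖ * ‖A‖ / (2 * ‖k 0‖) ^ 2) ^ 2 ≤ 4 ^ 2 := by
      nlinarith [pi_pos]
    have h3 := (sq_le_sq₀ (by positivity) (by norm_num)).1 h2
    rw [div_le_iff₀ (by positivity)] at h3
    refine (sq_le_sq₀ (norm_nonneg _) (by positivity)).1 ?_
    linarith
  · exact (measurableSet_annulus _ _).image_of_continuousOn_injOn (hψc.mono hsub)
      (hψinj.mono hsub)
  · refine ((isCompact_closedBall (0 : ℂ) (3 / 4)).image_of_continuousOn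
      (hψc.mono (closedBall_subset_ball (by norm_num)))).isBounded.subset (image_mono fun z hz => ?_)
    exact mem_closedBall_zero_iff.2 hz.2
  · rw [Set.disjoint_left]
    rintro _ ⟨z, hz, rfl⟩ ⟨w, hw, h⟩
    simp only [hφ w hw, hψ] at h
    have h1 : A / (k w - k 0) = -A / (k z + k 0) := by
      rw [neg_div]
      linear_combination h
    rw [div_eq_div_iff (hkne w hw) (hadd z (hsub hz) 0 h0), neg_mul, ← mul_neg] at h1
    refine hadd z (hsub hz) w hw.1 ?_
    linear_combination mul_left_cancel₀ hA0 h1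

/-- The **Koebe distortion theorem**, with the constant `1 / 8` in place of `1 / 4`. -/
theorem norm_deriv_le_eight_mul {g : ℂ → ℂ} (hg : DifferentiableOn ℂ g (ball 0 1))
    (hinj : InjOn g (ball 0 1)) {c : ℂ} (hc : c ∉ g '' ball 0 1) :
    ‖deriv g 0‖ ≤ 8 * ‖g 0 - c‖ := by
  have h0 : (0 : ℂ) ∈ ball (0 : ℂ) 1 := mem_ball_self one_pos
  obtain ⟨k, hkd, hk⟩ := exists_differentiableOn_sq_eq (f := fun z => g z - c)
    ((convex_ball (0 : ℂ) 1).isSimplyConnected ⟨0, h0⟩) isOpen_ball (hg.sub_const c)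
    fun z hz h => hc ⟨z, hz, sub_eq_zero.1 h⟩
  have hsq : ∀ z ∈ ball (0 : ℂ) 1, ∀ w ∈ ball (0 : ℂ) 1, k z ^ 2 = k w ^ 2 → z = w := by
    intro z hz w hw h
    rw [hk, hk] at h
    exact hinj hz hw (sub_left_injective h)
  have hadd : ∀ z ∈ ball (0 : ℂ) 1, ∀ w ∈ ball (0 : ℂ) 1, k z + k w ≠ 0 := by
    intro z hz w hw h
    have hzw : z = w := hsq z hz w hw (by linear_combination (k z - k w) * h)
    subst hzw
    refine hc ⟨z, hz, sub_eq_zero.1 ?_⟩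
    rw [← hk]
    linear_combination k z / 2 * h
  have h1 := norm_deriv_le_of_add_ne_zero hkd
    (fun z hz w hw h => hsq z hz w hw (by rw [h])) hadd
  have hnhds : ball (0 : ℂ) 1 ∈ 𝓝 0 := ball_mem_nhds 0 one_pos
  have h2 := (hkd.differentiableAt hnhds).hasDerivAt.fun_pow 2
  rw [show (fun z => k z ^ 2) = fun z => g z - c from funext hk] at h2
  have h3 := ((hg.differentiableAt hnhds).hasDerivAt.sub_const c).unique h2
  have h4 := congrArg norm (hk 0)
  rw [norm_pow] at h4
  rw [h3, ← h4]
  simp only [Nat.cast_ofNat, Nat.add_one_sub_one, pow_one, norm_mul, Complex.norm_ofNat]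
  nlinarith [norm_nonneg (k 0)]

end KoebeDistortion

/-! ### Hyperbolic density and distance to the boundary -/

section HyperbolicDensity

/-- In terms of a Riemann map, the hyperbolic density at the base point is the reciprocal of the
derivative at the origin. -/
theorem hyperbolicDensity_eq_inv_norm_deriv {U : Set ℂ} {a : ℂ} {F p : ℂ → ℂ} (hU : IsOpen U)
    (ha : a ∈ U) (hF : IsDiskEmbedding F U a) (hpF : LeftInvOn p F U)
    (hFp : LeftInvOn F p (ball 0 1)) (hcov : IsDiskUniversalCovering p U) :
    hyperbolicDensity U a = ‖deriv p 0‖⁻¹ := by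
  have h0 : (0 : ℂ) ∈ ball (0 : ℂ) 1 := mem_ball_self one_pos
  have hp0 : p 0 = a := by rw [← hF.map_base, hpF ha]
  have hFd := (hF.differentiableOn.differentiableAt (hU.mem_nhds ha)).hasDerivAt
  have hpd := (hcov.differentiableOn.differentiableAt (isOpen_ball.mem_nhds h0)).hasDerivAt
  have hmul : ‖deriv F a‖ * ‖deriv p 0‖ = 1 := by
    have h1 : HasDerivAt (F ∘ p) (deriv F a * deriv p 0) 0 :=
      HasDerivAt.comp 0 (by rwa [hp0]) hpd
    have h2 : HasDerivAt (F ∘ p) 1 0 := by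
      refine (hasDerivAt_id (0 : ℂ)).congr_of_eventuallyEq ?_
      filter_upwards [isOpen_ball.mem_nhds h0] with w hw using hFp hw
    rw [← norm_mul, h1.unique h2, norm_one]
  have hppos : 0 < ‖deriv p 0‖ := by
    refine (norm_nonneg _).lt_of_ne fun h => ?_
    rw [← h, mul_zero] at hmul
    exact zero_ne_one hmul
  refine IsLeast.csInf_eq ⟨⟨p, 0, hcov, h0, hp0, ?_⟩, ?_⟩
  · rw [inv_mul_cancel₀ hppos.ne']
    norm_num
  -- Only a lower bound for the infimum is needed, so Schwarz-Pick for `F ∘ P` suffices and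
  -- uniqueness of coverings is not invoked.
  · rintro r ⟨P, ζ, hP, hζ, hPζ, hr⟩
    obtain ⟨hPm, -⟩ := hP.isCoveringMap
    have hζ1 : ‖ζ‖ < 1 := mem_ball_zero_iff.1 hζ
    have hpos : 0 < 1 - ‖ζ‖ ^ 2 := by nlinarith [norm_nonneg ζ]
    have hsp := norm_deriv_mul_le_one_of_mapsTo
      (hF.differentiableOn.comp hP.differentiableOn hPm) (hF.mapsTo.comp hPm) hζ1
      (by simp [hPζ, hF.map_base])
    have hPd := (hP.differentiableOn.differentiableAt (isOpen_ball.mem_nhds hζ)).hasDerivAt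
    have h1 : HasDerivAt (F ∘ P) (deriv F a * deriv P ζ) ζ :=
      HasDerivAt.comp ζ (by rwa [hPζ]) hPd
    rw [h1.deriv, norm_mul] at hsp
    rw [eq_div_iff hpos.ne'] at hr
    have hr0 : 0 < r := by
      by_contra! h
      nlinarith [mul_nonneg (norm_nonneg (deriv P ζ)) hpos.le]
    rw [← eq_inv_of_mul_eq_one_left hmul]
    nlinarith

/-- A ball centered in an open set with radius the distance to the boundary lies in the set. -/
theorem ball_boundaryDist_subset {G : Set ℂ} (hG : IsOpen G) {w : ℂ} (hw : w ∈ G) :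
    ball w (boundaryDist G w) ⊆ G := by
  intro x hx
  have hpos : 0 < boundaryDist G w := pos_of_mem_ball hx
  refine (convex_ball w (boundaryDist G w)).isPreconnected.subset_left_of_subset_union hG
    isClosed_closure.isOpen_compl (disjoint_compl_right.mono_left subset_closure) ?_
    ⟨w, mem_ball_self hpos, hw⟩ hx
  intro y hy
  by_contra h
  rw [mem_union, mem_compl_iff, not_or, not_not] at h
  have hyf : y ∈ frontier G := by
    rw [hG.frontier_eq]
    exact ⟨h.2, h.1⟩
  have h1 := infDist_le_dist_of_mem (x := w) hyf
  rw [mem_ball, dist_comm] at hy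
  exact h1.not_gt hy

/-- Bounds for the distance to the boundary of the image of the unit disk. -/
theorem boundaryDist_image_ball_bounds {g : ℂ → ℂ} (hg : DifferentiableOn ℂ g (ball 0 1))
    (hinj : InjOn g (ball 0 1)) :
    0 < boundaryDist (g '' ball 0 1) (g 0) ∧
      boundaryDist (g '' ball 0 1) (g 0) ≤ ‖deriv g 0‖ ∧
      ‖deriv g 0‖ ≤ 8 * boundaryDist (g '' ball 0 1) (g 0) := by
  have h0 : (0 : ℂ) ∈ ball (0 : ℂ) 1 := mem_ball_self one_pos
  have hG : IsOpen (g '' ball 0 1) := isOpen_image_of_injOn isOpen_ball hg hinj isOpen_ball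
    Subset.rfl
  have hw : g 0 ∈ g '' ball 0 1 := mem_image_of_mem g h0
  have hd0 := deriv_ne_zero_of_injOn isOpen_ball hg hinj h0
  have hschwarz : ∀ R > 0, ball (g 0) R ⊆ g '' ball 0 1 → R ≤ ‖deriv g 0‖ := by
    intro R hR hsub
    have hinv := hinj.leftInvOn_invFunOn
    have h1 := Complex.norm_deriv_le_div_of_mapsTo_ball (R₂ := 1)
      ((differentiableOn_invFunOn isOpen_ball hg hinj).mono hsub) ?_ hR
    · rw [(hasDerivAt_invFunOn_of_deriv_ne_zero isOpen_ball hg hinj h0 hd0).deriv, norm_inv,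
        ← one_div] at h1
      exact (one_div_le_one_div (norm_pos_iff.2 hd0) hR).1 h1
    · rw [hinv h0]
      exact fun x hx => ball_subset_closedBall (Function.invFunOn_mem (hsub hx))
  -- Makes the frontier nonempty; for an empty frontier `infDist` would take its default value 0.
  have hne : g '' ball 0 1 ≠ univ := by
    intro h
    have := hschwarz (‖deriv g 0‖ + 1) (by positivity) (by rw [h]; exact subset_univ _)
    linarith
  have hfr : (frontier (g '' ball 0 1)).Nonempty := nonempty_frontier_iff.2 ⟨⟨_, hw⟩, hne⟩
  obtain ⟨c, hc, hdist⟩ := isClosed_frontier.exists_infDist_eq_dist hfr (g 0)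
  have hcG : c ∉ g '' ball 0 1 := by
    rw [hG.frontier_eq] at hc
    exact hc.2
  have hδ : boundaryDist (g '' ball 0 1) (g 0) = ‖g 0 - c‖ := hdist.trans (dist_eq_norm _ _)
  have hpos : 0 < boundaryDist (g '' ball 0 1) (g 0) := by
    rw [hδ, norm_pos_iff, sub_ne_zero]
    exact fun h => hcG (h ▸ hw)
  refine ⟨hpos, hschwarz _ hpos (ball_boundaryDist_subset hG hw), ?_⟩
  rw [hδ]
  exact norm_deriv_le_eight_mul hg hinj hcG

end HyperbolicDensity

/-! ### The two-sided estimate -/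

theorem corollary4p3 (D : Set ℂ) (hD : IsHyperbolicRegion D) (hconv : Convex ℝ D)
    (f : ℂ → ℂ) (hf : IsConformalMapping f D) (z : ℂ) (hz : z ∈ D) :
    (1 / 8 : ℝ) * hyperbolicDensity D z ≤ ‖deriv f z‖ / boundaryDist (f '' D) (f z) ∧
      ‖deriv f z‖ / boundaryDist (f '' D) (f z) ≤ 8 * hyperbolicDensity D z := by
  have hne : D ≠ univ := fun h => by
    obtain ⟨x, hx⟩ := hD.two_points.nonempty
    exact hx (h ▸ mem_univ x)
  obtain ⟨F, p, hF, hpd, hpm, hpF, hFp, hcov⟩ :=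
    exists_diskParametrization hD.isOpen (hconv.isSimplyConnected ⟨z, hz⟩) hne hz
  have hp0 : p 0 = z := by rw [← hF.map_base, hpF hz]
  have him : (f ∘ p) '' ball 0 1 = f '' D := by
    rw [image_comp, (hcov.surjOn.image_eq_of_mapsTo hpm)]
  have hgd : DifferentiableOn ℂ (f ∘ p) (ball 0 1) := hf.differentiableOn.comp hpd hpm
  have hgi : InjOn (f ∘ p) (ball 0 1) := hf.injOn.comp hFp.injOn hpm
  obtain ⟨hδ, hlow, hup⟩ := boundaryDist_image_ball_bounds hgd hgi
  have hg : HasDerivAt (f ∘ p) (deriv f z * deriv p 0) 0 := by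
    refine HasDerivAt.comp 0 ?_ (hpd.differentiableAt (ball_mem_nhds 0 one_pos)).hasDerivAt
    rw [hp0]
    exact (hf.differentiableOn.differentiableAt (hD.isOpen.mem_nhds hz)).hasDerivAt
  have hppos : 0 < ‖deriv p 0‖ :=
    norm_pos_iff.2 (deriv_ne_zero_of_injOn isOpen_ball hpd hFp.injOn (mem_ball_self one_pos))
  rw [him, Function.comp_apply, hp0] at hδ hlow hup
  rw [hg.deriv, norm_mul] at hlow hup
  rw [hyperbolicDensity_eq_inv_norm_deriv hD.isOpen hz hF hpF hFp hcov]
  constructor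
  -- The Schwarz bound `hlow` gives this side even with constant 1 in place of 1/8.
  · rw [← div_eq_mul_inv, div_le_div_iff₀ hppos hδ]
    linarith
  · rw [← div_eq_mul_inv, div_le_div_iff₀ hδ hppos]
    exact hup
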